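/- Throughout, spaces are pointed topological spaces and maps and homotopies are pointed. $\Omega Y$ is the loop space, and the fiber of $g:X\to Y$ is the homotopy fiber $\mathrm{fib}(g)=\{(x,c): c \text{ a path in } Y \text{ from } g(x) \text{ to the base point}\}$. A (pre)spectrum $Y$ consists of spaces $Y_n$ ($n\in\mathbb Z$) and maps $e_n:Y_n\to\Omega Y_{n+1}$; it is a spectrum ($\Omega$-spectrum) if every $e_n$ is a weak homotopy equivalence. A map $g:X\to Y$ consists of maps $g_n:X_n\to Y_n$ together with homotopies $e_n\circ g_n\sim\Omega g_{n+1}\circ e_n$. Its fiber $\mathrm{fib}_g$ is formed levelwise, $(\mathrm{fib}_g)_n=\mathrm{fib}(g_n)$. The homotopy groups are $\pi_n(Y)=\pi_2(Y_{2-n})$ for $n\in\mathbb Z$. Let $$\cdots\to A_s\xrightarrow{f_s}A_{s-1}\xrightarrow{f_{s-1}}A_{s-2}\to\cdots\qquad(s\in\mathbb Z)$$ be a sequence of spectra and maps of spectra, with fibers $B_s=\mathrm{fib}_{f_s}$. Put $D^{n,s}=\pi_n(A_s)$ and $E^{n,s}=\pi_n(B_s)$, and let - $i:D^{n,s}\to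 D^{n,s-1}$ be $\pi_n(f_s)$, - $k:E^{n,s}\to D^{n,s}$ be induced by the projection $B_s\to A_s$, - $j:D^{n,s}\to E^{n-1,s+1}$ be the connecting homomorphism, that is, the composite $\pi_2((A_s)_{2-n})\to\pi_2(\Omega (A_s)_{3-n})\to\pi_2((B_{s+1})_{3-n})$ of the maps induced by the structure map of $A_s$ and by the inclusion $\Omega Y\to\mathrm{fib}(g)$, $w\mapsto(*,w)$. Suppose that for every $n\in\mathbb Z$ there are integers $\beta_n$ and $\gamma_n$ such that $\pi_n(A_s)=0$ for all $s\le\beta_n$ and $\pi_n(f_s)$ is an isomorphism for all $s>\gamma_n$. Then $(D,E,i,j,k)$ is an exact couple, and it is bounded: for every $(n,s)$ there is $B\in\mathbb N$ such that $E^{n,s+t}=0$ and $D^{n,s-t}=0$ for all $t\ge B$. Moreover, reindex by $(p,q)=(s-n,-s)$, and let $(E_r,d_r)_{r\ge 2}$ be the spectral sequence obtained by iterating the derived couple (with $E_2=E$, $d=jk$, and $d_r$ of bidegree $(r,1-r)$). Then $$E_2^{p,q}=\pi_{-(p+q)}(B_{-q})\Rightarrow\pi_{-(p+q)}\bigl(A_{\gamma_{-(p+q)}}\bigr).$$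 That is: - $E_2^{p,q}\cong\pi_{-(p+q)}(B_{-q})$. - For each $(p,q)$ the differentials into and out of $E_r^{p,q}$ vanish for all large $r$, so that $E_r^{p,q}$ has an eventual value $E_\infty^{p,q}$. - For each $N\in\mathbb Z$ there are $q_0\in\mathbb Z$ and $m\in\mathbb N$ such that $E_\infty^{N-q,q}=0$ unless $q_0\le q<q_0+m$, and there are abelian groups $F_0=\pi_{-N}(A_{\gamma_{-N}}),F_1,\dots,F_m=0$ with short exact sequences $0\to E_\infty^{N-q_0-t,\,q_0+t}\to F_t\to F_{t+1}\to 0$ for $0\le t<m$. -/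

import Mathlib

universe u v

open CategoryTheory

namespace SpectralTower

/-! ### Graded homomorphisms and exact couples -/

section Graded

variable {G : Type v} [AddCommGroup G]

/-- A homomorphism of `G`-graded abelian groups of degree `deg`: it sends the summand at `x` to the
summand at `x + deg`. Taking the target index `y` with a proof of `x + deg = y` avoids transports
in compositions. -/
structure GradedHom (M N : G → Type u) [∀ x, AddCommGroup (M x)] [∀ x, AddCommGroup (N x)] where
  deg : G
  app : ∀ x y : G, x + deg = y → (M x →+ N y)

/-- Composition (first `φ`, then `ψ`). -/
def GradedHom.comp {M N P : G → Type u} [∀ x, AddCommGroup (M x)] [∀ x, AddCommGroup (N x)]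
    [∀ x, AddCommGroup (P x)] (ψ : GradedHom N P) (φ : GradedHom M N) : GradedHom M P where
  deg := φ.deg + ψ.deg
  app x z h := (ψ.app (x + φ.deg) z (by rw [← h, add_assoc])).comp (φ.app x (x + φ.deg) rfl)

/-- Exactness of `M → N → P` at every index. -/
def GradedHom.Exact {M N P : G → Type u} [∀ x, AddCommGroup (M x)] [∀ x, AddCommGroup (N x)]
    [∀ x, AddCommGroup (P x)] (φ : GradedHom M N) (ψ : GradedHom N P) : Prop :=
  ∀ (x y z : G) (h : x + φ.deg = y) (h' : y + ψ.deg = z),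
    Function.Exact (φ.app x y h) (ψ.app y z h')

end Graded

/-- The data of a couple of `G`-graded abelian groups: `i : D → D`, `j : D → E`, `k : E → D`. -/
structure Couple (G : Type v) [AddCommGroup G] where
  D : G → Type u
  E : G → Type u
  [instD : ∀ x, AddCommGroup (D x)]
  [instE : ∀ x, AddCommGroup (E x)]
  i : GradedHom D D
  j : GradedHom D E
  k : GradedHom E D

attribute [instance] Couple.instD Couple.instE

namespace Couple

variable {G : Type v} [AddCommGroup G]

/-- The couple is exact at its three vertices. -/
structure IsExact (C : Couple.{u} G) : Prop where
  exact_ij : C.i.Exact C.j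
  exact_jk : C.j.Exact C.k
  exact_ki : C.k.Exact C.i

/-- The differential `d = j ∘ k : E → E`. -/
def d (C : Couple.{u} G) : GradedHom C.E C.E := C.j.comp C.k

/-- Pullback of the grading along an isomorphism of the grading groups. -/
def reindex {H : Type v} [AddCommGroup H] (C : Couple.{u} G) (e : H ≃+ G) : Couple.{u} H where
  D x := C.D (e x)
  E x := C.E (e x)
  i := ⟨e.symm C.i.deg, fun x y h => C.i.app (e x) (e y) (by simp [← h])⟩
  j := ⟨e.symm C.j.deg, fun x y h => C.j.app (e x) (e y) (by simp [← h])⟩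
  k := ⟨e.symm C.k.deg, fun x y h => C.k.app (e x) (e y) (by simp [← h])⟩

end Couple

/-- An exact couple of `G`-graded abelian groups. -/
structure ExactCouple (G : Type v) [AddCommGroup G] extends Couple.{u} G where
  isExact : toCouple.IsExact

namespace ExactCouple

variable {G : Type v} [AddCommGroup G]

/-- Pullback of the grading of an exact couple along an isomorphism of the grading groups. -/
def reindex {H : Type v} [AddCommGroup H] (C : ExactCouple.{u} G) (e : H ≃+ G) :
    ExactCouple.{u} H where
  toCouple := C.toCouple.reindex e
  isExact :=
    ⟨fun x y z _ _ => C.isExact.exact_ij (e x) (e y) (e z) _ _,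
      fun x y z _ _ => C.isExact.exact_jk (e x) (e y) (e z) _ _,
      fun x y z _ _ => C.isExact.exact_ki (e x) (e y) (e z) _ _⟩

/-- An exact couple is bounded if for every index `x` both `E` at `x - s • deg i` and `D` at
`x + s • deg i` vanish for all sufficiently large natural numbers `s`. -/
def IsBounded (C : ExactCouple.{u} G) : Prop :=
  ∀ x : G, ∃ B : ℕ, ∀ s : ℕ, B ≤ s →
    Subsingleton (C.E (x - s • C.i.deg)) ∧ Subsingleton (C.D (x + s • C.i.deg))

variable (C : ExactCouple.{u} G)

lemma d_app (w x z : G) (h : w + C.k.deg = x) (h' : x + C.j.deg = z)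
    (hd : w + C.d.deg = z) (c : C.E w) :
    C.d.app w z hd c = C.j.app x z h' (C.k.app w x h c) := by
  subst h; rfl

lemma d_d (x y z : G) (h : x + C.d.deg = y) (h' : y + C.d.deg = z) (c : C.E x) :
    C.d.app y z h' (C.d.app x y h c) = 0 := by
  have hy : (x + C.k.deg) + C.j.deg = y := by rw [← h, add_assoc]; rfl
  have hz : (y + C.k.deg) + C.j.deg = z := by rw [← h', add_assoc]; rfl
  rw [C.d_app y _ z rfl hz, C.d_app x _ y rfl hy,
    (C.isExact.exact_jk _ _ _ hy rfl).apply_apply_eq_zero, map_zero]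

/-- The derived `D`: the image of `i` in degree `x`. -/
def imI (x : G) : AddSubgroup (C.D x) := (C.i.app (x - C.i.deg) x (sub_add_cancel _ _)).range

/-- The cycles: the kernel of `d` out of degree `x`. -/
def cyc (x : G) : AddSubgroup (C.E x) := (C.d.app x (x + C.d.deg) rfl).ker

/-- The boundaries: the image of `d` in degree `x`. -/
def bdry (x : G) : AddSubgroup (C.E x) := (C.d.app (x - C.d.deg) x (sub_add_cancel _ _)).range

/-- The derived `E`: the homology of `d` in degree `x`. -/
abbrev derivedE (x : G) : Type u := C.cyc x ⧸ (C.bdry x).addSubgroupOf (C.cyc x)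

lemma mem_imI {x y : G} (h : x + C.i.deg = y) (a : C.D y) :
    a ∈ C.imI y ↔ ∃ b, C.i.app x y h b = a := by
  obtain rfl : x = y - C.i.deg := eq_sub_of_add_eq h
  rfl

lemma mem_bdry {x y : G} (h : x + C.d.deg = y) (a : C.E y) :
    a ∈ C.bdry y ↔ ∃ b, C.d.app x y h b = a := by
  obtain rfl : x = y - C.d.deg := eq_sub_of_add_eq h
  rfl

lemma mem_cyc {x y : G} (h : x + C.d.deg = y) (a : C.E x) :
    a ∈ C.cyc x ↔ C.d.app x y h a = 0 := by
  subst h; rfl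

lemma mem_cyc_iff {x y : G} (h : x + C.k.deg = y) (a : C.E x) :
    a ∈ C.cyc x ↔ C.k.app x y h a ∈ C.imI y := by
  have hz : x + C.d.deg = y + C.j.deg := by rw [← h, add_assoc]; rfl
  rw [C.mem_cyc hz, C.d_app x y _ h rfl, C.isExact.exact_ij (y - C.i.deg) y _
    (sub_add_cancel _ _) rfl]
  rfl

lemma j_mem_cyc {x y : G} (h : x + C.j.deg = y) (b : C.D x) : C.j.app x y h b ∈ C.cyc y := by
  rw [C.mem_cyc_iff rfl, (C.isExact.exact_jk _ _ _ h rfl).apply_apply_eq_zero]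
  exact zero_mem _

lemma k_bdry {x y : G} (h : x + C.k.deg = y) (a : C.E x) (ha : a ∈ C.bdry x) :
    C.k.app x y h a = 0 := by
  obtain ⟨b, rfl⟩ := (C.mem_bdry (sub_add_cancel x _) a).1 ha
  have hz : (x - C.d.deg + C.k.deg) + C.j.deg = x := by
    rw [add_assoc]; exact sub_add_cancel x C.d.deg
  rw [C.d_app _ _ _ rfl hz, (C.isExact.exact_jk _ _ _ hz h).apply_apply_eq_zero]

/-- The derived `i`: the restriction of `i` to its image. -/
def derivedI : GradedHom (fun x => C.imI x) (fun x => C.imI x) where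
  deg := C.i.deg
  app x y h := ((C.i.app x y h).comp (C.imI x).subtype).codRestrict (C.imI y)
    fun a => (C.mem_imI h _).2 ⟨a, rfl⟩

/-- The derived `k`, sending the class of `a` to `k a`. -/
def derivedK : GradedHom C.derivedE (fun x => C.imI x) where
  deg := C.k.deg
  app x y h := QuotientAddGroup.lift _
    (((C.k.app x y h).comp (C.cyc x).subtype).codRestrict (C.imI y)
      fun a => (C.mem_cyc_iff h _).1 a.2)
    (fun a ha => Subtype.ext (C.k_bdry h a.1 (AddSubgroup.mem_addSubgroupOf.1 ha)))

/-- The map `b ↦ [j b]` to the homology of `d`. -/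
def jClass (x y : G) (h : x + C.j.deg = y) : C.D x →+ C.derivedE y :=
  (QuotientAddGroup.mk' _).comp ((C.j.app x y h).codRestrict (C.cyc y) (C.j_mem_cyc h))

lemma jClass_eq_zero_iff (x y w : G) (h : x + C.j.deg = y) (hw : w + C.k.deg = x) (b : C.D x) :
    C.jClass x y h b = 0 ↔ ∃ c, C.j.app x y h (C.k.app w x hw c) = C.j.app x y h b := by
  have hd : w + C.d.deg = y := by rw [← h, ← hw, add_assoc]; rfl
  have : C.jClass x y h b = 0 ↔ C.j.app x y h b ∈ C.bdry y := by
    refine (QuotientAddGroup.eq_zero_iff _).trans ?_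
    exact AddSubgroup.mem_addSubgroupOf
  rw [this, C.mem_bdry hd]
  simp only [C.d_app w x y hw h hd]

lemma ker_i_le_ker_jClass (x y z : G) (h : x + C.j.deg = y) (hi : x + C.i.deg = z) :
    (C.i.app x z hi).ker ≤ (C.jClass x y h).ker := by
  intro b hb
  obtain ⟨c, rfl⟩ := (C.isExact.exact_ki (x - C.k.deg) x z (sub_add_cancel _ _) hi b).1 hb
  exact (C.jClass_eq_zero_iff x y _ h (sub_add_cancel _ _) _).2 ⟨c, rfl⟩

/-- The derived `j`, sending `i b` to the class of `j b`. -/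
noncomputable def derivedJ : GradedHom (fun x => C.imI x) C.derivedE where
  deg := C.j.deg - C.i.deg
  app x y h :=
    (C.i.app (x - C.i.deg) x (sub_add_cancel _ _)).rangeRestrict.liftOfSurjective
      (AddMonoidHom.rangeRestrict_surjective _)
      ⟨C.jClass (x - C.i.deg) y (by rw [← h]; abel), by
        rw [AddMonoidHom.ker_rangeRestrict]
        exact C.ker_i_le_ker_jClass _ _ _ _ _⟩

lemma derivedJ_app (w x y : G) (hi : w + C.i.deg = x) (hj : w + C.j.deg = y)
    (h : x + C.derivedJ.deg = y) (b : C.D w) (hb : C.i.app w x hi b ∈ C.imI x) :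
    C.derivedJ.app x y h ⟨C.i.app w x hi b, hb⟩ = C.jClass w y hj b := by
  obtain rfl : w = x - C.i.deg := eq_sub_of_add_eq hi
  exact AddMonoidHom.liftOfRightInverse_comp_apply _ _ _ _ b

lemma derivedJ_deg (w x y : G) (hi : w + C.i.deg = x) :
    x + C.derivedJ.deg = y ↔ w + C.j.deg = y := by
  have : x + C.derivedJ.deg = w + C.j.deg := by
    change x + (C.j.deg - C.i.deg) = _
    rw [← hi]; abel
  rw [this]

lemma exact_derived_ij : C.derivedI.Exact C.derivedJ := by
  intro x y z h h' a
  have h1 : x + C.j.deg = z := (C.derivedJ_deg x y z h).1 h'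
  obtain ⟨a, ha⟩ := a
  constructor
  · intro h0
    obtain ⟨b, rfl⟩ := (C.mem_imI h a).1 ha
    rw [C.derivedJ_app x y z h h1 h'] at h0
    obtain ⟨c, hc⟩ := (C.jClass_eq_zero_iff x z (x - C.k.deg) h1 (sub_add_cancel _ _) b).1 h0
    have h2 : C.j.app x z h1 (b - C.k.app _ x (sub_add_cancel _ _) c) = 0 := by
      rw [map_sub, hc, sub_self]
    have h3 := (C.isExact.exact_ij (x - C.i.deg) x z (sub_add_cancel _ _) h1 _).1 h2
    refine ⟨⟨_, h3⟩, Subtype.ext ?_⟩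
    change C.i.app x y h (b - C.k.app _ x (sub_add_cancel _ _) c) = C.i.app x y h b
    rw [map_sub, (C.isExact.exact_ki _ _ _ _ h).apply_apply_eq_zero, sub_zero]
  · rintro ⟨⟨e, he⟩, h0⟩
    obtain rfl : C.i.app x y h e = a := congrArg Subtype.val h0
    rw [C.derivedJ_app x y z h h1 h']
    obtain ⟨b, rfl⟩ := (C.mem_imI (sub_add_cancel x _) e).1 he
    refine (C.jClass_eq_zero_iff x z (x - C.k.deg) h1 (sub_add_cancel _ _) _).2 ⟨0, ?_⟩
    rw [(C.isExact.exact_ij _ _ _ _ h1).apply_apply_eq_zero, map_zero, map_zero]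

lemma exact_derived_jk : C.derivedJ.Exact C.derivedK := by
  intro x y z h h' e
  have hx : (x - C.i.deg) + C.i.deg = x := sub_add_cancel _ _
  have h1 : (x - C.i.deg) + C.j.deg = y := (C.derivedJ_deg _ x y hx).1 h
  obtain ⟨c, rfl⟩ := QuotientAddGroup.mk_surjective e
  constructor
  · intro h0
    have h2 : C.k.app y z h' c.1 = 0 := congrArg Subtype.val h0
    obtain ⟨b, hb⟩ := (C.isExact.exact_jk _ _ _ h1 h' _).1 h2
    refine ⟨⟨C.i.app _ x hx b, (C.mem_imI hx _).2 ⟨b, rfl⟩⟩, ?_⟩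
    rw [C.derivedJ_app _ x y hx h1 h]
    exact congrArg (QuotientAddGroup.mk' _) (Subtype.ext hb)
  · rintro ⟨⟨a, ha⟩, h0⟩
    obtain ⟨b, rfl⟩ := (C.mem_imI hx a).1 ha
    rw [C.derivedJ_app _ x y hx h1 h] at h0
    rw [← h0]
    exact Subtype.ext ((C.isExact.exact_jk _ _ _ h1 h').apply_apply_eq_zero b)

lemma exact_derived_ki : C.derivedK.Exact C.derivedI := by
  intro x y z h h' a
  constructor
  · intro h0
    have h1 : C.i.app y z h' a.1 = 0 := congrArg Subtype.val h0
    obtain ⟨c, hc⟩ := (C.isExact.exact_ki _ _ _ h h' _).1 h1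
    have hcyc : c ∈ C.cyc x := (C.mem_cyc_iff h c).2 (hc ▸ a.2)
    exact ⟨QuotientAddGroup.mk' _ ⟨c, hcyc⟩, Subtype.ext hc⟩
  · rintro ⟨e, rfl⟩
    obtain ⟨c, rfl⟩ := QuotientAddGroup.mk_surjective e
    exact Subtype.ext ((C.isExact.exact_ki _ _ _ h h').apply_apply_eq_zero c.1)

/-- The derived exact couple. -/
noncomputable def derive : ExactCouple.{u} G where
  D x := C.imI x
  E := C.derivedE
  i := C.derivedI
  j := C.derivedJ
  k := C.derivedK
  isExact := ⟨C.exact_derived_ij, C.exact_derived_jk, C.exact_derived_ki⟩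

/-- The `n`-fold derived exact couple. -/
noncomputable def iterDerive : ℕ → ExactCouple.{u} G
  | 0 => C
  | n + 1 => (iterDerive n).derive

lemma iterDerive_i_deg (n : ℕ) : (C.iterDerive n).i.deg = C.i.deg := by
  induction n with
  | zero => rfl
  | succ n ih => exact ih

lemma iterDerive_d_deg (n : ℕ) : (C.iterDerive n).d.deg = C.d.deg - n • C.i.deg := by
  induction n with
  | zero => simp [iterDerive]
  | succ n ih =>
    have h : (C.iterDerive (n + 1)).d.deg = (C.iterDerive n).d.deg - (C.iterDerive n).i.deg := by
      change (C.iterDerive n).k.deg + ((C.iterDerive n).j.deg - (C.iterDerive n).i.deg) =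
        ((C.iterDerive n).k.deg + (C.iterDerive n).j.deg) - (C.iterDerive n).i.deg
      abel
    rw [h, ih, iterDerive_i_deg, succ_nsmul]
    abel

/-! ### The spectral sequence of an exact couple -/

/-- The cochain complex `(E, d)` of an exact couple whose differential has degree `a`. -/
noncomputable def complex (a : G) (ha : C.d.deg = a) :
    HomologicalComplex AddCommGrpCat.{u} (ComplexShape.up' a) where
  X x := AddCommGrpCat.of (C.E x)
  d x y := by
    classical
    exact if h : x + a = y then AddCommGrpCat.ofHom (C.d.app x y (by rw [ha, h])) else 0
  shape x y h := dif_neg h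
  d_comp_d' x y z h h' := by
    have h : x + a = y := h
    have h' : y + a = z := h'
    rw [dif_pos h, dif_pos h']
    ext c
    exact C.d_d x y z (by rw [ha, h]) (by rw [ha, h']) c

lemma complex_d (a : G) (ha : C.d.deg = a) (x y : G) (h : x + a = y) :
    (C.complex a ha).d x y = AddCommGrpCat.ofHom (C.d.app x y (by rw [ha, h])) :=
  dif_pos h

/-- The short complex `E → E → E` formed by the differentials into and out of degree `x`. -/
noncomputable def shortComplex (x : G) : ShortComplex AddCommGrpCat.{u} :=
  ShortComplex.mk (X₁ := AddCommGrpCat.of (C.E (x - C.d.deg))) (X₂ := AddCommGrpCat.of (C.E x))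
    (X₃ := AddCommGrpCat.of (C.E (x + C.d.deg)))
    (AddCommGrpCat.ofHom (C.d.app (x - C.d.deg) x (sub_add_cancel _ _)))
    (AddCommGrpCat.ofHom (C.d.app x (x + C.d.deg) rfl))
    (by ext c; exact C.d_d _ _ _ (sub_add_cancel _ _) rfl c)

/-- The homology of `E → E → E` in degree `x` is the `E` of the derived couple. -/
noncomputable def shortComplexHomologyIso (x : G) :
    (C.shortComplex x).homology ≅ AddCommGrpCat.of (C.derive.E x) := by
  let M : AddSubgroup (C.cyc x) := (C.shortComplex x).abToCycles.range
  have hM : M = (C.bdry x).addSubgroupOf (C.cyc x) := by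
    ext c
    rw [AddSubgroup.mem_addSubgroupOf]
    constructor
    · rintro ⟨b, rfl⟩
      exact ⟨b, rfl⟩
    · rintro ⟨b, hb⟩
      exact ⟨b, Subtype.ext hb⟩
  let e : (C.cyc x ⧸ M) ≃+ C.derivedE x := QuotientAddGroup.quotientAddEquivOfEq hM
  exact ShortComplex.abHomologyIso _ ≪≫ AddEquiv.toAddCommGrpIso e

/-- The homology of the complex `(E, d)` is the `E` of the derived couple. -/
noncomputable def complexHomologyIso (a : G) (ha : C.d.deg = a) (x : G) :
    (C.complex a ha).homology x ≅ AddCommGrpCat.of (C.derive.E x) :=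
  (C.complex a ha).homologyIsoSc' (x - C.d.deg) x (x + C.d.deg)
    ((ComplexShape.up' a).prev_eq' (by subst ha; exact sub_add_cancel _ _))
    ((ComplexShape.up' a).next_eq' (by subst ha; rfl)) ≪≫
  ShortComplex.homologyMapIso (S₂ := C.shortComplex x)
    (ShortComplex.isoMk (Iso.refl (AddCommGrpCat.of (C.E (x - C.d.deg))))
      (Iso.refl (AddCommGrpCat.of (C.E x))) (Iso.refl (AddCommGrpCat.of (C.E (x + C.d.deg))))
      (by
        refine (Category.id_comp _).trans (Eq.trans ?_ (Category.comp_id _).symm)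
        exact (C.complex_d a ha (x - C.d.deg) x (by rw [← ha, sub_add_cancel])).symm)
      (by
        refine (Category.id_comp _).trans (Eq.trans ?_ (Category.comp_id _).symm)
        exact (C.complex_d a ha x (x + C.d.deg) (by rw [← ha])).symm)) ≪≫
  C.shortComplexHomologyIso x

/-- The spectral sequence of a `ℤ × ℤ`-graded exact couple whose `i` has degree `(-1, 1)` and whose
differential `j ∘ k` has degree `(2, -1)`, the degrees for which the differential on the `r`-th
page has the cohomological degree `(r, 1 - r)`. The second page is the couple itself, and the page
`r` is given by its `(r - 2)`-fold derived couple. -/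
noncomputable def spectralSequence (C : ExactCouple.{u} (ℤ × ℤ)) (hi : C.i.deg = (-1, 1))
    (hd : C.d.deg = (2, -1)) : E₂CohomologicalSpectralSequence AddCommGrpCat.{u} where
  page r hr := (C.iterDerive (r - 2).toNat).complex (r, 1 - r) (by
    rw [iterDerive_d_deg, hi, hd]
    ext <;> simp <;> omega)
  iso r r' pq hrr' hr :=
    (C.iterDerive (r - 2).toNat).complexHomologyIso _ _ pq ≪≫
      eqToIso (by
        have h : (r' - 2).toNat = (r - 2).toNat + 1 := by omega
        change AddCommGrpCat.of ((C.iterDerive ((r - 2).toNat + 1)).E pq) =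
          AddCommGrpCat.of ((C.iterDerive (r' - 2).toNat).E pq)
        rw [h])

end ExactCouple

/-! ### Convergence -/

/-- The spectral sequence is constant at `pq` from page `r₀` on: all differentials into and out of
`E_r^{pq}` vanish for `r ≥ r₀`, so that the structure isomorphisms identify all `E_r^{pq}`,
`r ≥ r₀`, with each other. -/
def IsStableFrom (E : E₂CohomologicalSpectralSequence AddCommGrpCat.{u}) (pq : ℤ × ℤ) (r₀ : ℤ)
    (hr₀ : 2 ≤ r₀) : Prop :=
  ∀ (r : ℤ) (hr : r₀ ≤ r) (x : ℤ × ℤ),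
    (E.page r (hr₀.trans hr)).d pq x = 0 ∧ (E.page r (hr₀.trans hr)).d x pq = 0

/-- `D` is built from the finite sequence `E 0, …, E (m - 1)`: there are groups
`F 0 = D, F 1, …, F m = 0` and short exact sequences `0 → E k → F k → F (k + 1) → 0`
for `k < m`. -/
def IsBuiltFrom (D : AddCommGrpCat.{u}) (m : ℕ) (E : ℕ → AddCommGrpCat.{u}) : Prop :=
  ∃ F : ℕ → AddCommGrpCat.{u}, Nonempty (F 0 ≅ D) ∧ Subsingleton (F m) ∧
    ∀ k < m, ∃ (a : E k →+ F k) (b : F k →+ F (k + 1)),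
      Function.Injective a ∧ Function.Exact a b ∧ Function.Surjective b

/-- The spectral sequence `E` gives `E_2^{p,q} = C^{p,q} ⇒ D^{p+q}`: the second page is `C`, for each
`(p, q)` the pages are eventually constant, with eventual value `E_∞^{p,q}`, and for each `n` only
finitely many `E_∞^{p,q}` with `p + q = n` are nontrivial and `D^n` is built from these
(consecutively, in the order of increasing `q`). -/
structure ConvergesTo (E : E₂CohomologicalSpectralSequence AddCommGrpCat.{u})
    (C : ℤ → ℤ → AddCommGrpCat.{u}) (D : ℤ → AddCommGrpCat.{u}) : Prop where
  second_page : ∀ p q : ℤ, Nonempty ((E.page 2).X (p, q) ≅ C p q)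
  abutment : ∃ (R : ℤ × ℤ → ℤ) (hR : ∀ pq, 2 ≤ R pq),
    (∀ pq, IsStableFrom E pq (R pq) (hR pq)) ∧
    ∀ n : ℤ, ∃ (q₀ : ℤ) (m : ℕ),
      IsBuiltFrom (D n) m (fun t =>
        (E.page (R (n - (q₀ + t), q₀ + t)) (hR _)).X (n - (q₀ + t), q₀ + t)) ∧
      ∀ q : ℤ, (q < q₀ ∨ q₀ + m ≤ q) →
        Subsingleton ((E.page (R (n - q, q)) (hR _)).X (n - q, q))


/-! ### Pointed spaces, loop spaces and homotopy fibers -/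

open scoped unitInterval

/-- A pointed topological space. -/
structure PtdSpace where
  carrier : Type u
  [top : TopologicalSpace carrier]
  pt : carrier

attribute [instance] PtdSpace.top

instance : CoeSort PtdSpace.{u} (Type u) := ⟨PtdSpace.carrier⟩

/-- A pointed continuous map. -/
structure PtdMap (X Y : PtdSpace.{u}) where
  toMap : C(X, Y)
  map_pt : toMap X.pt = Y.pt

namespace PtdMap

/-- Composition (first `f`, then `g`). -/
def comp {X Y Z : PtdSpace.{u}} (g : PtdMap Y Z) (f : PtdMap X Y) : PtdMap X Z where
  toMap := g.toMap.comp f.toMap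
  map_pt := by simp [f.map_pt, g.map_pt]

/-- A pointed homotopy: a homotopy that is constant on the base point. -/
abbrev Homotopy {X Y : PtdSpace.{u}} (f g : PtdMap X Y) : Type u :=
  ContinuousMap.HomotopyRel f.toMap g.toMap {X.pt}

end PtdMap

/-- The loop space `Ω X`, based at the constant loop. -/
def PtdSpace.loop (X : PtdSpace.{u}) : PtdSpace.{u} := ⟨Path X.pt X.pt, Path.refl X.pt⟩

/-- Evaluation of loops. -/
def PtdSpace.loopEval (X : PtdSpace.{u}) : C(X.loop × I, X) where
  toFun p := (show Path X.pt X.pt from p.1) p.2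
  continuous_toFun := by
    change Continuous fun p : Path X.pt X.pt × I => p.1 p.2
    fun_prop

/-- The map `Ω f`. -/
def PtdMap.loop {X Y : PtdSpace.{u}} (f : PtdMap X Y) : PtdMap X.loop Y.loop where
  toMap :=
    { toFun := fun (w : Path X.pt X.pt) =>
        (w.map f.toMap.continuous).cast f.map_pt.symm f.map_pt.symm
      continuous_toFun := by
        refine Path.continuous_uncurry_iff.1 ?_
        change Continuous fun p : Path X.pt X.pt × I => f.toMap (p.1 p.2)
        fun_prop }
  map_pt := by
    refine Path.ext (funext fun t => ?_)
    exact f.map_pt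

/-- The homotopy fiber of `f`: pairs of a point `x` and a path from `f x` to the base point. -/
def PtdMap.fiber {X Y : PtdSpace.{u}} (f : PtdMap X Y) : PtdSpace.{u} where
  carrier := {z : X × C(I, Y) // z.2 0 = f.toMap z.1 ∧ z.2 1 = Y.pt}
  pt := ⟨(X.pt, ContinuousMap.const I Y.pt), f.map_pt.symm, rfl⟩

/-- The first projection `fib f → X`. -/
def PtdMap.fiberProj {X Y : PtdSpace.{u}} (f : PtdMap X Y) : PtdMap f.fiber X where
  toMap := ⟨fun z => z.1.1, continuous_fst.comp continuous_subtype_val⟩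
  map_pt := rfl

/-- The inclusion `Ω Y → fib f`, sending a loop `w` to `(pt, w)`. -/
def PtdMap.fiberIncl {X Y : PtdSpace.{u}} (f : PtdMap X Y) : PtdMap Y.loop f.fiber where
  toMap :=
    { toFun := fun (w : Path Y.pt Y.pt) =>
        ⟨(X.pt, w.toContinuousMap), w.source.trans f.map_pt.symm, w.target⟩
      continuous_toFun := by
        refine Continuous.subtype_mk (continuous_const.prodMk ?_) _
        exact continuous_induced_dom }
  map_pt := rfl

/-! ### Homotopy groups -/

open scoped Topology Topology.Homotopy

/-- The map on generalized loops induced by a continuous map `f` with `f x = y`. -/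
def genLoopMap (N : Type) {X Y : Type u} [TopologicalSpace X] [TopologicalSpace Y] (f : C(X, Y))
    {x : X} {y : Y} (h : f x = y) (p : GenLoop N X x) : GenLoop N Y y :=
  ⟨f.comp p.1, fun t ht => by rw [ContinuousMap.comp_apply, p.2 t ht, h]⟩

/-- The map on homotopy groups induced by a continuous map `f` with `f x = y`. -/
def homotopyGroupMap (N : Type) {X Y : Type u} [TopologicalSpace X] [TopologicalSpace Y]
    (f : C(X, Y)) {x : X} {y : Y} (h : f x = y) : HomotopyGroup N X x → HomotopyGroup N Y y :=
  Quotient.map (genLoopMap N f h) fun _ _ H => ContinuousMap.HomotopicRel.comp_continuousMap H f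

/-- A weak homotopy equivalence between nonempty (below: pointed) spaces: a continuous map that induces bijections
on `π_n` for all `n ≥ 0` and all base points (`π_0` is the set of path components). -/
def IsWeakEquiv {X Y : Type u} [TopologicalSpace X] [TopologicalSpace Y] (f : C(X, Y)) : Prop :=
  ∀ (n : ℕ) (x : X), Function.Bijective (homotopyGroupMap (Fin n) f (rfl : f x = f x))

/-- The abelian group `π_2` of a pointed space, written additively. -/
abbrev PtdSpace.pi2 (X : PtdSpace.{u}) : Type u := Additive (HomotopyGroup.Pi 2 X X.pt)

lemma homotopyGroupMap_mul {X Y : Type u} [TopologicalSpace X] [TopologicalSpace Y]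
    (f : C(X, Y)) {x : X} {y : Y} (h : f x = y) (a b : HomotopyGroup.Pi 2 X x) :
    homotopyGroupMap (Fin 2) f h (a * b) =
      homotopyGroupMap (Fin 2) f h a * homotopyGroupMap (Fin 2) f h b := by
  induction a using Quotient.inductionOn with | _ p => ?_
  induction b using Quotient.inductionOn with | _ q => ?_
  have e1 := HomotopyGroup.mul_spec (i := (0 : Fin 2)) (p := p) (q := q)
  have e2 := HomotopyGroup.mul_spec (i := (0 : Fin 2)) (p := genLoopMap (Fin 2) f h p)
    (q := genLoopMap (Fin 2) f h q)
  refine (congrArg (homotopyGroupMap (Fin 2) f h) e1).trans (Eq.trans ?_ e2.symm)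
  refine congrArg (Quotient.mk _) (GenLoop.ext _ _ fun t => ?_)
  change f (GenLoop.transAt 0 q p t) = _
  simp only [GenLoop.transAt, GenLoop.coe_copy]
  split_ifs <;> rfl

/-- The homomorphism `π_2(f)`. -/
noncomputable def PtdMap.pi2 {X Y : PtdSpace.{u}} (f : PtdMap X Y) : X.pi2 →+ Y.pi2 :=
  MonoidHom.toAdditive (MonoidHom.mk' (homotopyGroupMap (Fin 2) f.toMap f.map_pt)
    (homotopyGroupMap_mul f.toMap f.map_pt))

/-! ### Spectra -/

/-- A prespectrum, indexed by the integers. -/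
structure Prespectrum where
  space : ℤ → PtdSpace.{u}
  struct : ∀ n : ℤ, PtdMap (space n) (space (n + 1)).loop

/-- An `Ω`-spectrum: a prespectrum whose structure maps are weak homotopy equivalences. -/
structure Spectrum extends Prespectrum.{u} where
  isWeakEquiv : ∀ n : ℤ, IsWeakEquiv (struct n).toMap

/-- The structure map `X_m → Ω X_{m'}` for `m + 1 = m'`. -/
def Prespectrum.structTo (X : Prespectrum.{u}) (m m' : ℤ) (h : m + 1 = m') :
    PtdMap (X.space m) (X.space m').loop :=
  h ▸ X.struct m

/-- A map of prespectra: pointed maps that commute with the structure maps up to given pointed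
homotopies. -/
structure SpectrumMap (X Y : Prespectrum.{u}) where
  map : ∀ n : ℤ, PtdMap (X.space n) (Y.space n)
  comm : ∀ n : ℤ, ((Y.struct n).comp (map n)).Homotopy ((map (n + 1)).loop.comp (X.struct n))

/-- The homotopy group `π_n(X) = π_2(X_{2 - n})`, `n ∈ ℤ`, of an `Ω`-spectrum (and of the levelwise
fiber of a map of `Ω`-spectra, whose structure maps are weak homotopy equivalences as well). -/
abbrev Prespectrum.homotopyGroup (X : Prespectrum.{u}) (n : ℤ) : Type u := (X.space (2 - n)).pi2

/-- The homomorphism `π_n(f) = π_2(f_{2 - n})`. -/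
noncomputable def SpectrumMap.homotopyMap {X Y : Prespectrum.{u}} (f : SpectrumMap X Y) (n : ℤ) :
    X.homotopyGroup n →+ Y.homotopyGroup n :=
  (f.map (2 - n)).pi2

namespace SpectrumMap

variable {X Y : Prespectrum.{u}} (f : SpectrumMap X Y)

/-- For `z = (x, c)` in the fiber of `f_n`, the path in `Ω Y_{n+1}` from `Ω f_{n+1} (e x)` to
`e (f_n x)` given by the homotopy between `Ω f_{n+1} ∘ e` and `e ∘ f_n`. -/
def fiberPathFst (n : ℤ) (z : (f.map n).fiber) :
    Path ((f.map (n + 1)).loop.toMap ((X.struct n).toMap z.1.1))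
      ((Y.struct n).toMap ((f.map n).toMap z.1.1)) :=
  ((f.comm n).toHomotopy.evalAt z.1.1).symm

/-- For `z = (x, c)` in the fiber of `f_n`, the path `e ∘ c` in `Ω Y_{n+1}` from `e (f_n x)` to the
constant loop. -/
def fiberPathSnd (n : ℤ) (z : (f.map n).fiber) :
    Path ((Y.struct n).toMap ((f.map n).toMap z.1.1)) (Y.space (n + 1)).loop.pt where
  toFun := fun t => (Y.struct n).toMap (z.1.2 t)
  continuous_toFun := by fun_prop
  source' := by rw [z.2.1]
  target' := by rw [z.2.2, (Y.struct n).map_pt]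

/-- For `z = (x, c)` in the fiber of `f_n`, the composite path in `Ω Y_{n+1}` from
`Ω f_{n+1} (e x)` to the constant loop. -/
noncomputable def fiberPath (n : ℤ) (z : (f.map n).fiber) :
    Path ((f.map (n + 1)).loop.toMap ((X.struct n).toMap z.1.1)) (Y.space (n + 1)).loop.pt :=
  (f.fiberPathFst n z).trans (f.fiberPathSnd n z)

lemma continuous_fiberPath (n : ℤ) :
    Continuous fun p : (f.map n).fiber × I => f.fiberPath n p.1 p.2 := by
  refine Path.trans_continuous_family (f.fiberPathFst n) ?_ (f.fiberPathSnd n) ?_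
  · change Continuous fun p : (f.map n).fiber × I => (f.comm n) (unitInterval.symm p.2, p.1.1.1)
    exact (map_continuous (f.comm n)).comp
      ((unitInterval.continuous_symm.comp continuous_snd).prodMk
        ((continuous_fst.comp continuous_subtype_val).comp continuous_fst))
  · change Continuous fun p : (f.map n).fiber × I => (Y.struct n).toMap (p.1.1.2 p.2)
    have : Continuous fun p : (f.map n).fiber × I => p.1.1.2 p.2 :=
      ((continuous_snd.comp continuous_subtype_val).comp continuous_fst).eval continuous_snd
    exact (map_continuous _).comp this

lemma fiberPath_pt (n : ℤ) (s : I) :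
    f.fiberPath n (f.map n).fiber.pt s = (Y.space (n + 1)).loop.pt := by
  have h1 : ∀ t : I, (f.comm n) (t, (X.space n).pt) = (Y.space (n + 1)).loop.pt := fun t =>
    ((f.comm n).eq_snd t rfl).trans ((f.map (n + 1)).loop.comp (X.struct n)).map_pt
  refine (Path.trans_apply _ _ _).trans ?_
  split_ifs
  · exact h1 _
  · exact (Y.struct n).map_pt

/-- The point of `fib(f_{n+1})` at time `t` of the loop assigned to `z = (x, c)`: the point
`(e x)(t)` with the path `s ↦ (fiberPath z s)(t)`. -/
noncomputable def fiberLoopAt (n : ℤ) (z : (f.map n).fiber) (t : I) : (f.map (n + 1)).fiber :=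
  ⟨((X.space (n + 1)).loopEval ((X.struct n).toMap z.1.1, t),
    ⟨fun s => (Y.space (n + 1)).loopEval (f.fiberPath n z s, t), by fun_prop⟩),
    congrArg (fun w => (Y.space (n + 1)).loopEval (w, t)) (f.fiberPath n z).source,
    congrArg (fun w => (Y.space (n + 1)).loopEval (w, t)) (f.fiberPath n z).target⟩

lemma continuous_fiberLoopAt (n : ℤ) :
    Continuous fun p : (f.map n).fiber × I => f.fiberLoopAt n p.1 p.2 := by
  refine Continuous.subtype_mk (Continuous.prodMk ?_ ?_) _
  · have h : Continuous fun p : (f.map n).fiber × I => (X.struct n).toMap p.1.1.1 :=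
      (map_continuous _).comp ((continuous_fst.comp continuous_subtype_val).comp continuous_fst)
    exact (map_continuous (X.space (n + 1)).loopEval).comp (h.prodMk continuous_snd)
  · refine ContinuousMap.continuous_of_continuous_uncurry _ ?_
    change Continuous fun p : ((f.map n).fiber × I) × I =>
      (Y.space (n + 1)).loopEval (f.fiberPath n p.1.1 p.2, p.1.2)
    have h : Continuous fun p : ((f.map n).fiber × I) × I => f.fiberPath n p.1.1 p.2 :=
      (f.continuous_fiberPath n).comp ((continuous_fst.comp continuous_fst).prodMk continuous_snd)
    exact (map_continuous _).comp (h.prodMk (continuous_snd.comp continuous_fst))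

lemma fiberLoopAt_eq_pt (n : ℤ) (z : (f.map n).fiber) (t : I)
    (h1 : (X.space (n + 1)).loopEval ((X.struct n).toMap z.1.1, t) = (X.space (n + 1)).pt)
    (h2 : ∀ s, (Y.space (n + 1)).loopEval (f.fiberPath n z s, t) = (Y.space (n + 1)).pt) :
    f.fiberLoopAt n z t = (f.map (n + 1)).fiber.pt :=
  Subtype.ext (Prod.ext h1 (ContinuousMap.ext h2))

/-- The structure map `fib(f_n) → Ω fib(f_{n+1})`: the map `fib(f_n) → fib(Ω f_{n+1})` induced by
the structure maps of `X` and `Y` and the homotopy that relates them, followed by the interchange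
homeomorphism `fib(Ω f_{n+1}) ≃ Ω fib(f_{n+1})`. -/
noncomputable def fiberStruct (n : ℤ) : PtdMap (f.map n).fiber (f.map (n + 1)).fiber.loop where
  toMap :=
    { toFun := fun z =>
        ({ toFun := f.fiberLoopAt n z
           continuous_toFun := (f.continuous_fiberLoopAt n).comp (continuous_const.prodMk continuous_id)
           source' := f.fiberLoopAt_eq_pt n z 0 (Path.source _) fun _ => Path.source _
           target' := f.fiberLoopAt_eq_pt n z 1 (Path.target _) fun _ => Path.target _ } :
          Path (f.map (n + 1)).fiber.pt (f.map (n + 1)).fiber.pt)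
      continuous_toFun := by
        refine Path.continuous_uncurry_iff.1 ?_
        exact f.continuous_fiberLoopAt n }
  map_pt := by
    refine Path.ext (funext fun t => f.fiberLoopAt_eq_pt n _ t ?_ fun s => ?_)
    · exact congrArg (fun w => (X.space (n + 1)).loopEval (w, t)) (X.struct n).map_pt
    · exact congrArg (fun w => (Y.space (n + 1)).loopEval (w, t)) (f.fiberPath_pt n s)

/-- The fiber of a map of prespectra, formed levelwise. -/
noncomputable def fiber : Prespectrum.{u} where
  space n := (f.map n).fiber
  struct n := f.fiberStruct n

end SpectrumMap

namespace SpectrumMap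

variable {X Y : Prespectrum.{u}} (f : SpectrumMap X Y)

/-- The map of prespectra `p_1 : fib f → X`. -/
noncomputable def fiberProj : SpectrumMap f.fiber X where
  map n := (f.map n).fiberProj
  comm _ := (ContinuousMap.HomotopyRel.refl _ _).cast rfl
    (ContinuousMap.ext fun _ => Path.ext (funext fun _ => rfl))

/-- The connecting homomorphism `π_{n+1}(Y) → π_n(fib f)`: with `m = 2 - n` it is the composite
`π_2(Y_{m-1}) → π_2(Ω Y_m) → π_2(fib f_m)`. -/
noncomputable def connecting (n : ℤ) : Y.homotopyGroup (n + 1) →+ f.fiber.homotopyGroup n :=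
  ((f.map (2 - n)).fiberIncl.pi2).comp (Y.structTo (2 - (n + 1)) (2 - n) (by ring)).pi2

end SpectrumMap

/-! ### The couple and the spectral sequence of a tower of spectra -/

/-- The identification of two summands of a graded group with equal indices. -/
def gradedCast {G : Type v} (M : G → Type u) [∀ x, AddCommGroup (M x)] {x y : G} (h : x = y) :
    M x →+ M y :=
  h ▸ AddMonoidHom.id (M x)

section Tower

variable (A : ℤ → Spectrum.{u})
  (f : ∀ s : ℤ, SpectrumMap (A s).toPrespectrum (A (s - 1)).toPrespectrum)

/-- `D^{n,s} = π_n(A_s)`, indexed by `(n, s)`. -/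
abbrev towerD (x : ℤ × ℤ) : Type u := (A x.2).homotopyGroup x.1

/-- `E^{n,s} = π_n(B_s)`, indexed by `(n, s)`, where `B_s` is the fiber of `f_s`. -/
abbrev towerE (x : ℤ × ℤ) : Type u := (f x.2).fiber.homotopyGroup x.1

/-- The couple of a tower of spectra, indexed by `(n, s)`: `i` is `π_n(A_s) → π_n(A_{s-1})`, `j` is
the connecting homomorphism `π_n(A_s) → π_{n-1}(B_{s+1})` and `k` is `π_n(B_s) → π_n(A_s)`. -/
noncomputable def towerCouple : Couple.{u} (ℤ × ℤ) where
  D := towerD A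
  E := towerE A f
  i :=
    { deg := (0, -1)
      app := fun x y h =>
        (gradedCast (towerD A) (x := (x.1, x.2 - 1)) (y := y)
          (h ▸ Prod.ext (add_zero x.1).symm rfl)).comp ((f x.2).homotopyMap x.1) }
  j :=
    { deg := (-1, 1)
      app := fun x y h =>
        ((f y.2).connecting y.1).comp
          (gradedCast (towerD A) (x := x) (y := (y.1 + 1, y.2 - 1))
            (by subst h; ext <;> simp)) }
  k :=
    { deg := 0
      app := fun x y h =>
        (gradedCast (towerD A) (x := x) (y := y) ((add_zero x).symm.trans h)).comp
          ((f x.2).fiberProj.homotopyMap x.1) }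

/-- The base change `(p, q) ↦ (n, s) = (-(p + q), -q)`, with inverse `(n, s) ↦ (s - n, -s)`. -/
def baseChange : ℤ × ℤ ≃+ ℤ × ℤ where
  toFun x := (-(x.1 + x.2), -x.2)
  invFun x := (x.2 - x.1, -x.2)
  left_inv x := by ext <;> simp
  right_inv x := by ext <;> simp
  map_add' x y := by ext <;> simp <;> ring

/-- The exact couple of a tower of spectra (given that its couple is exact). -/
noncomputable def towerExactCouple (h : (towerCouple A f).IsExact) : ExactCouple.{u} (ℤ × ℤ) where
  toCouple := towerCouple A f
  isExact := h

/-- The spectral sequence of a tower of spectra, in the indexing `(p, q) = (s - n, -s)`. -/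
noncomputable def towerSpectralSequence (h : (towerCouple A f).IsExact) :
    E₂CohomologicalSpectralSequence AddCommGrpCat.{u} :=
  ((towerExactCouple A f h).reindex baseChange).spectralSequence rfl rfl

end Tower

end SpectralTower

namespace SpectralTower

open scoped unitInterval Topology Topology.Homotopy

/-! ### Homotopies of generalized loops -/

section GenLoop

variable {N : Type} {X Y : Type u} [TopologicalSpace X] [TopologicalSpace Y] {x : X} {y : Y}

/-! Exactness is the fiber sequence `ΩX → ΩY → fib f → X → Y` seen by `π_2`. Each exactness
statement is an explicit homotopy: a null-homotopy of `f ∘ p` is a lift of `p` to the fiber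
(`PtdMap.exact_fiberProj`), and the other two places are settled by reparametrizing such homotopies
(`PtdMap.exact_fiberIncl_fiberProj`, `PtdMap.exact_loop_fiberIncl`). The structure maps of the
Ω-spectra are bijective on `π_2` and commute with the maps up to homotopy, so they replace
`π_2(ΩY_m)` by `π_2(Y_{m-1})` and give the three exactness conditions of the couple.

Boundedness: `D` vanishes far down the tower by hypothesis; far up, `E` lies between two
isomorphisms in the long exact sequence and so vanishes.

Convergence is algebra of bounded exact couples (`ExactCouple.convergesTo_spectralSequence`). After
`n` derivations `D` is replaced by the image of the `n`-fold iterate of `i`, and the source of the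
map `j` into a fixed `E` has moved `n` steps along `i`, to where `D` is zero. Hence `k` is
eventually injective and `E_∞` is the kernel of `i` on the iterated images. Start on a line of fixed
total degree at an index `q₀` before which `i` is bijective. The iterated image at `q₀ + t` then
stabilizes to `F_t`, the image of `D` at `q₀`. The map `i : F_t → F_{t+1}` is onto with kernel
`E_∞`, and `F_m` is zero since it lies in a zero group. -/

/-- Relative homotopies as plain maps on a product, so that they can be curried, glued and
reparametrized. -/
lemma genLoop_homotopic_iff (p q : GenLoop N X x) :
    GenLoop.Homotopic p q ↔ ∃ H : C(I × (N → I), X), (∀ z, H (0, z) = p z) ∧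
      (∀ z, H (1, z) = q z) ∧ ∀ t, ∀ z ∈ Cube.boundary N, H (t, z) = x := by
  constructor
  · rintro ⟨H⟩
    exact ⟨H.toContinuousMap, fun z => H.map_zero_left z, fun z => H.map_one_left z,
      fun t z hz => (H.eq_fst t hz).trans (p.2 z hz)⟩
  · rintro ⟨H, h0, h1, hb⟩
    exact ⟨⟨⟨H, h0, h1⟩, fun t z hz => (hb t z hz).trans (p.2 z hz).symm⟩⟩

lemma homotopyGroupMap_congr {f g : C(X, Y)} (hf : f x = y) (hg : g x = y)
    (H : f.HomotopyRel g {x}) : homotopyGroupMap N f hf = homotopyGroupMap N g hg := by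
  funext a
  induction a using Quotient.inductionOn with | _ p => ?_
  refine Quotient.sound ((genLoop_homotopic_iff _ _).2
    ⟨H.toContinuousMap.comp ((ContinuousMap.id I).prodMap p.1), ?_, ?_, ?_⟩)
  · exact fun z => H.map_zero_left (p z)
  · exact fun z => H.map_one_left (p z)
  · intro t z hz
    exact (congrArg (fun w => H (t, w)) (p.2 z hz)).trans ((H.eq_fst t rfl).trans hf)

lemma IsWeakEquiv.bijective {f : C(X, Y)} (hf : IsWeakEquiv f) (n : ℕ) (h : f x = y) :
    Function.Bijective (homotopyGroupMap (Fin n) f h) := by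
  subst h
  exact hf n x

end GenLoop

/-! ### The exact sequence of a homotopy fiber -/

section Fiber

variable {X Y : PtdSpace.{u}}

/-- The class of a generalized loop. -/
def piMk (p : GenLoop (Fin 2) X X.pt) : X.pi2 := Additive.ofMul (Quotient.mk _ p)

lemma piMk_surjective (a : X.pi2) : ∃ p, piMk p = a := Quotient.exists_rep a

lemma piMk_eq_iff (p q : GenLoop (Fin 2) X X.pt) :
    piMk p = piMk q ↔ GenLoop.Homotopic p q :=
  ⟨fun h => Quotient.exact h, fun h => Quotient.sound h⟩

lemma piMk_eq_zero_iff (p : GenLoop (Fin 2) X X.pt) :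
    piMk p = 0 ↔ GenLoop.Homotopic p GenLoop.const := by
  rw [← piMk_eq_iff]
  exact Iff.of_eq (congrArg (piMk p = ·) (HomotopyGroup.one_def (N := Fin 2)))

lemma pi2_piMk (f : PtdMap X Y) (p : GenLoop (Fin 2) X X.pt) :
    f.pi2 (piMk p) = piMk (genLoopMap (Fin 2) f.toMap f.map_pt p) := rfl

lemma PtdMap.pi2_comp {Z : PtdSpace.{u}} (g : PtdMap Y Z) (f : PtdMap X Y) (a : X.pi2) :
    (g.comp f).pi2 a = g.pi2 (f.pi2 a) := by
  obtain ⟨p, rfl⟩ := piMk_surjective a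
  rfl

lemma PtdMap.pi2_congr {f g : PtdMap X Y} (H : f.Homotopy g) : f.pi2 = g.pi2 :=
  AddMonoidHom.ext fun a => congrFun (homotopyGroupMap_congr f.map_pt g.map_pt H) a

/-- A map to the homotopy fiber from its two components. -/
def PtdMap.fiberLift (f : PtdMap X Y) {W : Type} [TopologicalSpace W] (a : C(W, X))
    (c : C(W × I, Y)) (h0 : ∀ w, c (w, 0) = f.toMap (a w)) (h1 : ∀ w, c (w, 1) = Y.pt) :
    C(W, f.fiber) where
  toFun w := ⟨(a w, c.curry w), h0 w, h1 w⟩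
  continuous_toFun := (a.continuous.prodMk c.curry.continuous).subtype_mk _

/-- Evaluation of the paths that are part of the points of the homotopy fiber. -/
def PtdMap.fiberEval (f : PtdMap X Y) : C(f.fiber × I, Y) where
  toFun p := p.1.1.2 p.2
  continuous_toFun :=
    ((continuous_snd.comp continuous_subtype_val).comp continuous_fst).eval continuous_snd

/-- A map to the loop space from its adjoint. -/
def PtdSpace.loopLift (X : PtdSpace.{u}) {W : Type} [TopologicalSpace W]
    (c : C(W × I, X)) (h0 : ∀ w, c (w, 0) = X.pt) (h1 : ∀ w, c (w, 1) = X.pt) :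
    C(W, X.loop) where
  toFun w := (⟨c.curry w, h0 w, h1 w⟩ : Path X.pt X.pt)
  continuous_toFun := continuous_induced_rng.2 c.curry.continuous

lemma PtdMap.fiber_ext (f : PtdMap X Y) {z w : f.fiber} (h : z.1.1 = w.1.1)
    (h' : ∀ t, z.1.2 t = w.1.2 t) : z = w :=
  Subtype.ext (Prod.ext h (ContinuousMap.ext h'))

/-- A null-homotopy of `f ∘ p`, read as a family of paths to the base point, is the second component
of a lift of `p`. Conversely, the paths carried by a map to the fiber contract the image of its
first component. -/
lemma PtdMap.exact_fiberProj (f : PtdMap X Y) : Function.Exact f.fiberProj.pi2 f.pi2 := by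
  intro a
  obtain ⟨p, rfl⟩ := piMk_surjective a
  rw [pi2_piMk, piMk_eq_zero_iff, genLoop_homotopic_iff]
  constructor
  · rintro ⟨H, h0, h1, hb⟩
    refine ⟨piMk ⟨f.fiberLift p.1 (H.comp ContinuousMap.prodSwap) (fun z => h0 z)
      (fun z => h1 z), fun z hz => f.fiber_ext (p.2 z hz) fun t => hb t z hz⟩, ?_⟩
    rfl
  · rintro ⟨b, hb⟩
    obtain ⟨q, rfl⟩ := piMk_surjective b
    rw [pi2_piMk, piMk_eq_iff] at hb
    have h1 : GenLoop.Homotopic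
        (genLoopMap (Fin 2) f.toMap f.map_pt (genLoopMap (Fin 2) f.fiberProj.toMap rfl q))
        (genLoopMap (Fin 2) f.toMap f.map_pt p) :=
      ContinuousMap.HomotopicRel.comp_continuousMap hb f.toMap
    have h2 : GenLoop.Homotopic
        (genLoopMap (Fin 2) f.toMap f.map_pt (genLoopMap (Fin 2) f.fiberProj.toMap rfl q))
        GenLoop.const :=
      (genLoop_homotopic_iff _ _).2
        ⟨(f.fiberEval.comp (q.1.prodMap (ContinuousMap.id I))).comp ContinuousMap.prodSwap,
          fun z => (q z).2.1, fun z => (q z).2.2, fun t z hz =>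
            congrArg (fun w => f.fiberEval (w, t)) (q.2 z hz)⟩
    exact (genLoop_homotopic_iff _ _).1 (h1.symm.trans h2)

/-- The path `f H⁻¹` followed by `c`, as a function on `[-1, 1]`. -/
noncomputable def gluedPath {W : Type} (H : I × W → Y) (c : W × I → Y) (p : W × ℝ) : Y :=
  if p.2 ≤ 0 then H (Set.projIcc 0 1 zero_le_one (-p.2), p.1)
  else c (p.1, Set.projIcc 0 1 zero_le_one p.2)

lemma continuous_gluedPath {W : Type} [TopologicalSpace W] (H : C(I × W, Y)) (c : C(W × I, Y))
    (h : ∀ w, H (0, w) = c (w, 0)) : Continuous (gluedPath H c) := by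
  refine Continuous.if_le ?_ ?_ continuous_snd continuous_const ?_
  · fun_prop
  · fun_prop
  · rintro ⟨w, t⟩ (rfl : t = 0)
    simpa using h w

/-- If `H` contracts the first component of `p`, dragging the start of each path `c` back along `f ∘
H` turns it into a loop, and the dragging is a homotopy in the fiber. -/
lemma PtdMap.exact_fiberIncl_fiberProj (f : PtdMap X Y) :
    Function.Exact f.fiberIncl.pi2 f.fiberProj.pi2 := by
  intro a
  obtain ⟨p, rfl⟩ := piMk_surjective a
  constructor
  · rw [pi2_piMk, piMk_eq_zero_iff, genLoop_homotopic_iff]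
    rintro ⟨H, h0, h1, hb⟩
    let c : C((Fin 2 → I) × I, Y) := f.fiberEval.comp (p.1.prodMap (ContinuousMap.id I))
    let H' : C(I × (Fin 2 → I), Y) := f.toMap.comp H
    have hc : ∀ z, H' (0, z) = c (z, 0) := fun z =>
      (congrArg f.toMap (h0 z)).trans (p z).2.1.symm
    have hK := continuous_gluedPath H' c hc
    have hKb : ∀ z ∈ Cube.boundary (Fin 2), ∀ t, gluedPath H' c (z, t) = Y.pt := by
      intro z hz t
      unfold gluedPath
      split_ifs
      · exact (congrArg f.toMap (hb _ z hz)).trans f.map_pt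
      · exact congrArg (fun w => f.fiberEval (w, _)) (p.2 z hz)
    have hK0 : ∀ z (u : I), gluedPath H' c (z, -(u : ℝ)) = f.toMap (H (u, z)) := by
      intro z u
      simp [gluedPath, u.2.1, H']
    have hK1 : ∀ z, gluedPath H' c (z, 1) = Y.pt := by
      intro z
      have : gluedPath H' c (z, 1) = c (z, 1) := by simp [gluedPath]
      exact this.trans (p z).2.2
    have hKp : ∀ z (s : I), gluedPath H' c (z, s) = c (z, s) := by
      intro z s
      unfold gluedPath
      split_ifs with hs
      · have : s = 0 := le_antisymm hs s.2.1
        subst this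
        simpa using hc z
      · simp
    -- At time `u` the glued path is run affinely over `[-u, 1]`: this starts at `f (H (u, z))`,
    -- equals `c` for `u = 0` and is a loop for `u = 1`.
    let G : C((I × (Fin 2 → I)) × I, Y) :=
      ⟨fun q => gluedPath H' c (q.1.2, (q.2 : ℝ) - q.1.1 * (1 - q.2)), hK.comp (by fun_prop)⟩
    -- The factor `1` is kept so that `L` agrees with `G` at time `1` by `rfl`.
    let L : C((Fin 2 → I) × I, Y) :=
      ⟨fun q => gluedPath H' c (q.1, (q.2 : ℝ) - 1 * (1 - q.2)), hK.comp (by fun_prop)⟩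
    refine ⟨piMk ⟨Y.loopLift L (fun z => ?_) (fun z => ?_), fun z hz => ?_⟩, ?_⟩
    · have := hK0 z 1
      simp only [h1] at this
      simpa [L, f.map_pt] using this
    · simpa [L] using hK1 z
    · exact Path.ext (funext fun t => hKb z hz _)
    · rw [pi2_piMk, piMk_eq_iff]
      refine GenLoop.Homotopic.symm ((genLoop_homotopic_iff _ _).2
        ⟨f.fiberLift H G (fun w => ?_) (fun w => ?_), fun z => ?_, fun z => ?_, fun t z hz => ?_⟩)
      · simpa [G] using hK0 w.2 w.1
      · simpa [G] using hK1 w.2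
      · refine f.fiber_ext (h0 z) fun t => ?_
        change gluedPath H' c (z, (t : ℝ) - (0 : ℝ) * (1 - t)) = c (z, t)
        rw [zero_mul, sub_zero, hKp]
      · exact f.fiber_ext (h1 z) fun t => rfl
      · exact f.fiber_ext (hb t z hz) fun t => hKb z hz _
  · rintro ⟨b, hb⟩
    obtain ⟨q, rfl⟩ := piMk_surjective b
    rw [← hb, pi2_piMk, pi2_piMk, piMk_eq_zero_iff]
    exact (genLoop_homotopic_iff _ _).2
      ⟨ContinuousMap.const _ X.pt, fun _ => rfl, fun _ => rfl, fun _ _ _ => rfl⟩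

/-- A null-homotopy in the fiber gives, for each `z`, a square in `Y` with `p z` on the side `u =
0`, the `f`-image of a loop in `X` on the side `s = 0`, and the base point on the other two.
Sweeping across the square deforms one loop into the other. -/
lemma PtdMap.exact_loop_fiberIncl (f : PtdMap X Y) :
    Function.Exact f.loop.pi2 f.fiberIncl.pi2 := by
  intro a
  obtain ⟨p, rfl⟩ := piMk_surjective a
  constructor
  · rw [pi2_piMk, piMk_eq_zero_iff, genLoop_homotopic_iff]
    rintro ⟨H, h0, h1, hb⟩
    let G : C((I × (Fin 2 → I)) × I, Y) := f.fiberEval.comp (H.prodMap (ContinuousMap.id I))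
    have G00 : ∀ z s, G ((0, z), s) = Y.loopEval (p z, s) := fun z s =>
      congrArg (fun w : f.fiber => w.1.2 s) (h0 z)
    have G0 : ∀ u z, G ((u, z), 0) = f.toMap (H (u, z)).1.1 := fun u z => (H (u, z)).2.1
    have G1 : ∀ u z, G ((u, z), 1) = Y.pt := fun u z => (H (u, z)).2.2
    have G11 : ∀ z s, G ((1, z), s) = Y.pt := fun z s =>
      congrArg (fun w : f.fiber => w.1.2 s) (h1 z)
    have Gb : ∀ z ∈ Cube.boundary (Fin 2), ∀ u s, G ((u, z), s) = Y.pt := fun z hz u s =>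
      congrArg (fun w : f.fiber => w.1.2 s) (hb u z hz)
    let P : ℝ → I := Set.projIcc 0 1 zero_le_one
    have hP : Continuous P := continuous_projIcc
    have P0 : P 0 = 0 := Set.projIcc_left _
    have P1 : ∀ x, 1 ≤ x → P x = 1 := fun x hx => Set.projIcc_of_right_le _ hx
    let A : C((Fin 2 → I) × I, X) :=
      f.fiberProj.toMap.comp (H.comp ContinuousMap.prodSwap)
    -- The loops are segments from the corner `(0, 0)` of the square to a point that moves along `s
    -- = 1` and then `u = 1`, from `(0, 1)` to `(1, 0)`; the clamp `P` produces this broken path of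
    -- endpoints.
    let K : C((I × (Fin 2 → I)) × I, Y) :=
      ⟨fun q => G ((q.2 * P (2 * q.1.1), q.1.2), q.2 * P (2 - 2 * q.1.1)), by fun_prop⟩
    refine ⟨piMk ⟨X.loopLift A (fun z => ?_) (fun z => ?_), fun z hz => ?_⟩, ?_⟩
    · exact congrArg (fun w : f.fiber => w.1.1) (h0 z)
    · exact congrArg (fun w : f.fiber => w.1.1) (h1 z)
    · exact Path.ext (funext fun t => congrArg (fun w : f.fiber => w.1.1) (hb t z hz))
    · rw [pi2_piMk, piMk_eq_iff]
      refine GenLoop.Homotopic.symm ((genLoop_homotopic_iff _ _).2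
        ⟨Y.loopLift K (fun w => ?_) (fun w => ?_), fun z => ?_, fun z => ?_, fun t z hz => ?_⟩)
      · change G ((0 * _, _), 0 * _) = _
        rw [zero_mul, zero_mul, G00]
        exact Path.source _
      · change G ((1 * P (2 * w.1), w.2), 1 * P (2 - 2 * w.1)) = _
        rw [one_mul, one_mul]
        rcases le_total (1 / 2 : ℝ) w.1 with h | h
        · rw [P1 _ (by linarith), G11]
        · rw [P1 (2 - _) (by linarith), G1]
      · refine Path.ext (funext fun t => ?_)
        change G ((t * P (2 * (0 : ℝ)), z), t * P (2 - 2 * (0 : ℝ))) = Y.loopEval (p z, t)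
        rw [mul_zero, P0, sub_zero, P1 2 (by norm_num), mul_zero, mul_one, G00]
      · refine Path.ext (funext fun t => ?_)
        change G ((t * P (2 * (1 : ℝ)), z), t * P (2 - 2 * (1 : ℝ))) = f.toMap (H (t, z)).1.1
        rw [mul_one, sub_self, P0, P1 2 (by norm_num), mul_zero, mul_one, G0]
      · exact Path.ext (funext fun s => Gb z hz _ _)
  · rintro ⟨b, hb⟩
    obtain ⟨q, rfl⟩ := piMk_surjective b
    rw [← hb, pi2_piMk, pi2_piMk, piMk_eq_zero_iff]
    let A : C(I × (Fin 2 → I), X) :=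
      (X.loopEval.comp (q.1.prodMap (ContinuousMap.id I))).comp ContinuousMap.prodSwap
    have A0 : ∀ z, A (0, z) = X.pt := fun z => Path.source (x := X.pt) (y := X.pt) (q z)
    have A1 : ∀ z, A (1, z) = X.pt := fun z => Path.target (x := X.pt) (y := X.pt) (q z)
    have Ab : ∀ z ∈ Cube.boundary (Fin 2), ∀ t, A (t, z) = X.pt := fun z hz t =>
      congrArg (fun w => X.loopEval (w, t)) (q.2 z hz)
    -- The loop in `X` is traversed up to time `u`, carrying the remainder of its image as the path:
    -- `1 - (1 - u)(1 - s)` runs from `u` to `1`.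
    let K : C((I × (Fin 2 → I)) × I, Y) :=
      ⟨fun w => f.toMap (A (σ (σ w.1.1 * σ w.2), w.1.2)), by fun_prop⟩
    refine (genLoop_homotopic_iff _ _).2 ⟨f.fiberLift A K (fun w => ?_) (fun w => ?_),
      fun z => ?_, fun z => ?_, fun t z hz => ?_⟩
    · change f.toMap (A (σ (σ w.1 * σ 0), w.2)) = f.toMap (A (w.1, w.2))
      rw [unitInterval.symm_zero, mul_one, unitInterval.symm_symm]
    · change f.toMap (A (σ (σ w.1 * σ 1), w.2)) = _
      rw [unitInterval.symm_one, mul_zero, unitInterval.symm_zero, A1, f.map_pt]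
    · refine f.fiber_ext (A0 z) fun t => ?_
      change f.toMap (A (σ (σ 0 * σ t), z)) = f.toMap (A (t, z))
      rw [unitInterval.symm_zero, one_mul, unitInterval.symm_symm]
    · refine f.fiber_ext (A1 z) fun t => ?_
      change f.toMap (A (σ (σ 1 * σ t), z)) = Y.pt
      rw [unitInterval.symm_one, zero_mul, unitInterval.symm_zero, A1, f.map_pt]
    · refine f.fiber_ext (Ab z hz t) fun s => ?_
      change f.toMap (A (σ (σ t * σ s), z)) = Y.pt
      rw [Ab z hz, f.map_pt]

end Fiber

/-! ### Convergence of the spectral sequence of a bounded exact couple -/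

namespace ExactCouple

variable {G : Type v} [AddCommGroup G] (C : ExactCouple.{u} G)

/-! ### Degrees, vanishing and surjectivity under iterated derivation, and stable pages -/

lemma iterDerive_k_deg (n : ℕ) : (C.iterDerive n).k.deg = C.k.deg := by
  induction n with
  | zero => rfl
  | succ n ih => exact ih

lemma iterDerive_j_deg (n : ℕ) : (C.iterDerive n).j.deg = C.j.deg - n • C.i.deg := by
  induction n with
  | zero => simp [iterDerive]
  | succ n ih =>
    change (C.iterDerive n).j.deg - (C.iterDerive n).i.deg = _
    rw [ih, iterDerive_i_deg, succ_nsmul]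
    abel

lemma subsingleton_iterDerive_D {x : G} (h : Subsingleton (C.D x)) (n : ℕ) :
    Subsingleton ((C.iterDerive n).D x) := by
  induction n with
  | zero => exact h
  | succ n ih => exact inferInstanceAs (Subsingleton ((C.iterDerive n).imI x))

lemma subsingleton_iterDerive_E {x : G} (h : Subsingleton (C.E x)) (n : ℕ) :
    Subsingleton ((C.iterDerive n).E x) := by
  induction n with
  | zero => exact h
  | succ n ih =>
    refine subsingleton_of_forall_eq 0 fun a => ?_
    obtain ⟨c, rfl⟩ := QuotientAddGroup.mk_surjective a
    rw [Subsingleton.elim c 0]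
    rfl

lemma injective_iterDerive_i {x y : G} {h : x + C.i.deg = y}
    (hi : Function.Injective (C.i.app x y h)) (n : ℕ) (h' : x + (C.iterDerive n).i.deg = y) :
    Function.Injective ((C.iterDerive n).i.app x y h') := by
  induction n with
  | zero => exact hi
  | succ n ih => exact fun a b hab => Subtype.ext (ih h' (congrArg Subtype.val hab))

/-- Each derivation pushes surjectivity one step further along `i`, since the derived `D` in degree
`x` is still all of `D x`. -/
lemma surjective_derive_i {w x y : G} (hw : w + C.i.deg = x) (hx : x + C.i.deg = y)
    (hs : Function.Surjective (C.i.app w x hw)) :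
    Function.Surjective (C.derive.i.app x y hx) := by
  rintro ⟨a, ha⟩
  obtain ⟨b, rfl⟩ := (C.mem_imI hx a).1 ha
  exact ⟨⟨b, (C.mem_imI hw b).2 (hs b)⟩, rfl⟩

/-- If the maps `i` into `x - l • deg i` are surjective for all `l`, then the `i` of the `n`-fold
derived couple into `x + t • deg i` is surjective for `t ≤ n`. -/
lemma surjective_iterDerive_i (x : G)
    (hs : ∀ (l : ℕ) (w : G) (h : w + C.i.deg = x - l • C.i.deg),
      Function.Surjective (C.i.app w _ h)) (n : ℕ) :
    ∀ t ≤ n, ∀ (w y : G) (_ : y = x + t • C.i.deg) (h : w + (C.iterDerive n).i.deg = y),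
      Function.Surjective ((C.iterDerive n).i.app w y h) := by
  -- The inductive step passes from `l` to `l - 1`, so the claim is needed for negative `l` too;
  -- there it starts from `hs`.
  suffices H : ∀ (l : ℤ), l ≤ n → ∀ (w y : G) (_ : y = x + l • C.i.deg)
      (h : w + (C.iterDerive n).i.deg = y), Function.Surjective ((C.iterDerive n).i.app w y h) from
    fun t ht w y hy h => H t (by exact_mod_cast ht) w y (by rw [hy, natCast_zsmul]) h
  induction n with
  | zero =>
    intro l hl w y hy h
    obtain ⟨k, rfl⟩ : ∃ k : ℕ, l = -(k : ℤ) := ⟨l.natAbs, by grind⟩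
    obtain rfl : y = x - k • C.i.deg := by
      rw [hy, neg_zsmul, natCast_zsmul, sub_eq_add_neg]
    exact hs k w h
  | succ n ih =>
    intro l hl w y hy h
    refine surjective_derive_i (C.iterDerive n) (sub_add_cancel w _) h
      (ih (l - 1) (by push_cast at hl; omega) _ _ ?_ _)
    have hw : w = y - (C.iterDerive n).i.deg := eq_sub_of_add_eq h
    rw [hw, hy, iterDerive_i_deg, sub_zsmul, one_zsmul]
    abel

/-- From page `t` on, the group `D` in degree `x` does not change if the maps `i` into degree `x` are
surjective. -/
lemma exists_equiv_iterDerive_D {t n : ℕ} (htn : t ≤ n) (x y : G)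
    (hs : ∀ m, t ≤ m → ∀ (w : G) (h : w + (C.iterDerive m).i.deg = x),
      Function.Surjective ((C.iterDerive m).i.app w x h)) :
    ∃ φ : (C.iterDerive n).D x ≃+ (C.iterDerive t).D x,
      ∀ (h : x + (C.iterDerive n).i.deg = y) (h' : x + (C.iterDerive t).i.deg = y)
        (a : (C.iterDerive n).D x),
        (C.iterDerive t).i.app x y h' (φ a) = 0 ↔ (C.iterDerive n).i.app x y h a = 0 := by
  induction n, htn using Nat.le_induction with
  | base => exact ⟨AddEquiv.refl _, fun _ _ _ => Iff.rfl⟩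
  | succ n hn ih =>
    obtain ⟨φ, hφ⟩ := ih
    -- As `i` is onto, the next `D` is the whole group. The identification is the inclusion, which
    -- commutes with `i` and so preserves its kernel.
    have htop : (C.iterDerive n).imI x = ⊤ :=
      AddMonoidHom.range_eq_top.2 (hs n hn _ _)
    let ψ : (C.iterDerive (n + 1)).D x ≃+ (C.iterDerive n).D x :=
      AddEquiv.ofBijective ((C.iterDerive n).imI x).subtype
        ⟨Subtype.val_injective, fun a => ⟨⟨a, htop ▸ AddSubgroup.mem_top a⟩, rfl⟩⟩
    refine ⟨ψ.trans φ, fun h h' a => (hφ h h' (ψ a)).trans ?_⟩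
    exact (Subtype.ext_iff (a1 := (C.iterDerive (n + 1)).i.app x y h a) (a2 := 0)).symm

lemma injective_k {v w x : G} (hj : v + C.j.deg = w) (hk : w + C.k.deg = x)
    (h : Subsingleton (C.D v)) : Function.Injective (C.k.app w x hk) := by
  refine (injective_iff_map_eq_zero _).2 fun a ha => ?_
  obtain ⟨b, rfl⟩ := (C.isExact.exact_jk v w x hj hk a).1 ha
  rw [Subsingleton.elim b 0, map_zero]

lemma subsingleton_E {w x y : G} (hk : w + C.k.deg = x) (hi : x + C.i.deg = y)
    (hinj : Function.Injective (C.k.app w x hk)) (h : Function.Injective (C.i.app x y hi)) :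
    Subsingleton (C.E w) := by
  refine subsingleton_of_forall_eq 0 fun a => hinj (h ?_)
  rw [(C.isExact.exact_ki w x y hk hi).apply_apply_eq_zero, map_zero, map_zero]

/-- A page number from which on the `E` of the derived couples is constant in degree `x`. -/
def IsStable (x : G) (n : ℕ) : Prop :=
  ∀ m, n ≤ m → Subsingleton (C.E (x + (C.iterDerive m).d.deg)) ∧
    Subsingleton (C.D (x - (C.iterDerive m).j.deg))

variable {C}

/-- The degrees of `d` and `j` drop by `deg i` with each derivation: the target of `d` recedes
against `i`, where `E` vanishes, and the source of `j` advances along `i`, where `D` vanishes. -/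
lemma IsBounded.exists_isStable (hC : C.IsBounded) (x : G) : ∃ n, C.IsStable x n := by
  obtain ⟨B₁, h₁⟩ := hC (x + C.d.deg)
  obtain ⟨B₂, h₂⟩ := hC (x - C.j.deg)
  refine ⟨max B₁ B₂, fun m hm => ⟨?_, ?_⟩⟩
  · rw [iterDerive_d_deg, add_sub]
    exact (h₁ m ((le_max_left _ _).trans hm)).1
  · rw [iterDerive_j_deg, ← sub_add]
    exact (h₂ m ((le_max_right _ _).trans hm)).2

lemma IsStable.mono {x : G} {n m : ℕ} (h : C.IsStable x n) (hnm : n ≤ m) : C.IsStable x m :=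
  fun l hl => h l (hnm.trans hl)

lemma IsStable.injective_k {w x : G} {n : ℕ} (h : C.IsStable w n)
    (hk : w + (C.iterDerive n).k.deg = x) :
    Function.Injective ((C.iterDerive n).k.app w x hk) :=
  (C.iterDerive n).injective_k (sub_add_cancel _ _) hk
    (C.subsingleton_iterDerive_D (h n le_rfl).2 n)

lemma IsStable.subsingleton {w x y : G} {n : ℕ} (h : C.IsStable w n) (hk : w + C.k.deg = x)
    (hi : x + C.i.deg = y) (hinj : Function.Injective (C.i.app x y hi)) :
    Subsingleton ((C.iterDerive n).E w) :=
  (C.iterDerive n).subsingleton_E (by rw [iterDerive_k_deg, hk]) (by rw [iterDerive_i_deg, hi])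
    (h.injective_k _) (C.injective_iterDerive_i hinj n _)

lemma IsStable.d_from {w y : G} {n m : ℕ} (h : C.IsStable w n) (hm : n ≤ m)
    (hd : w + (C.iterDerive m).d.deg = y) : (C.iterDerive m).d.app w y hd = 0 := by
  subst hd
  have := C.subsingleton_iterDerive_E (h m hm).1 m
  exact AddMonoidHom.ext fun a => Subsingleton.elim _ _

/-- The differential `j ∘ k` into `w` factors through the vanishing source of `j`. -/
lemma IsStable.d_to {v w : G} {n m : ℕ} (h : C.IsStable w n) (hm : n ≤ m)
    (hd : v + (C.iterDerive m).d.deg = w) : (C.iterDerive m).d.app v w hd = 0 := by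
  have := C.subsingleton_iterDerive_D (h m hm).2 m
  have hk : v + (C.iterDerive m).k.deg = w - (C.iterDerive m).j.deg := by
    rw [← hd]
    change _ = v + ((C.iterDerive m).k.deg + (C.iterDerive m).j.deg) - (C.iterDerive m).j.deg
    abel
  refine AddMonoidHom.ext fun a => ?_
  rw [d_app _ v _ w hk (sub_add_cancel _ _) hd, Subsingleton.elim (GradedHom.app _ _ _ hk a) 0,
    map_zero]
  rfl

lemma IsStable.complex_d_from {w : G} {n m : ℕ} (h : C.IsStable w n) (hm : n ≤ m) (a : G)
    (ha : (C.iterDerive m).d.deg = a) (y : G) : ((C.iterDerive m).complex a ha).d w y = 0 := by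
  by_cases hy : w + a = y
  · rw [complex_d _ _ _ _ _ hy, h.d_from hm]
    rfl
  · exact dif_neg hy

lemma IsStable.complex_d_to {w : G} {n m : ℕ} (h : C.IsStable w n) (hm : n ≤ m) (a : G)
    (ha : (C.iterDerive m).d.deg = a) (y : G) : ((C.iterDerive m).complex a ha).d y w = 0 := by
  by_cases hy : y + a = w
  · rw [complex_d _ _ _ _ _ hy, h.d_to hm]
    rfl
  · exact dif_neg hy

/-- The group `D` of the `t`-fold derived couple in degree `x` is an extension of the `D` of
the `(t + 1)`-fold derived couple in degree `x + deg i` by the limit term. -/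
lemma IsStable.exists_exact {w x y : G} {n t : ℕ} (h : C.IsStable w n) (htn : t ≤ n)
    (hk : w + C.k.deg = x) (hi : x + C.i.deg = y)
    (hs : ∀ m, t ≤ m → ∀ (v : G) (h : v + (C.iterDerive m).i.deg = x),
      Function.Surjective ((C.iterDerive m).i.app v x h)) :
    ∃ (a : (C.iterDerive n).E w →+ (C.iterDerive t).D x)
      (b : (C.iterDerive t).D x →+ (C.iterDerive (t + 1)).D y),
      Function.Injective a ∧ Function.Exact a b ∧ Function.Surjective b := by
  obtain ⟨φ, hφ⟩ := C.exists_equiv_iterDerive_D htn x y hs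
  have hk' : w + (C.iterDerive n).k.deg = x := by rw [iterDerive_k_deg, hk]
  have hin : x + (C.iterDerive n).i.deg = y := by rw [iterDerive_i_deg, hi]
  have hit : x + (C.iterDerive t).i.deg = y := by rw [iterDerive_i_deg, hi]
  -- `E` lives on page `n` but `D` on page `t`, so `k` is transported by `φ`; `i` is surjective
  -- because its target is by definition its image.
  refine ⟨φ.toAddMonoidHom.comp ((C.iterDerive n).k.app w x hk'),
    ((C.iterDerive t).i.app x y hit).codRestrict ((C.iterDerive t).imI y)
      fun a => ((C.iterDerive t).mem_imI hit _).2 ⟨a, rfl⟩,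
    φ.injective.comp (h.injective_k hk'), fun c => ?_, ?_⟩
  · obtain ⟨c, rfl⟩ := φ.surjective c
    have h1 := (hφ hin hit c).trans ((C.iterDerive n).isExact.exact_ki w x y hk' hin c)
    refine (Subtype.ext_iff.trans h1).trans ⟨?_, ?_⟩
    · rintro ⟨e, rfl⟩
      exact ⟨e, rfl⟩
    · rintro ⟨e, he⟩
      exact ⟨e, φ.injective he⟩
  · rintro ⟨c, hc⟩
    obtain ⟨b, rfl⟩ := ((C.iterDerive t).mem_imI hit c).1 hc
    exact ⟨b, rfl⟩

end ExactCouple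

/-- A bounded exact couple with `deg k = 0` whose maps `i` on the line of total degree `n` are
bijective before the index `q₀ n` gives a spectral sequence converging to the groups `D` at
`q₀ n`. -/
theorem ExactCouple.convergesTo_spectralSequence (C : ExactCouple.{u} (ℤ × ℤ))
    (hi : C.i.deg = (-1, 1)) (hd : C.d.deg = (2, -1)) (hk : C.k.deg = 0) (hC : C.IsBounded)
    (q₀ : ℤ → ℤ)
    (hq : ∀ (n q : ℤ), q < q₀ n → ∀ (y : ℤ × ℤ) (h : (n - q, q) + C.i.deg = y),
      Function.Bijective (C.i.app (n - q, q) y h)) :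
    ConvergesTo (C.spectralSequence hi hd) (fun p q => AddCommGrpCat.of (C.E (p, q)))
      (fun n => AddCommGrpCat.of (C.D (n - q₀ n, q₀ n))) := by
  choose S hS using hC.exists_isStable
  -- The second entry is `t` at the index `q₀ + t`; it secures the condition `t ≤ n` of
  -- `IsStable.exists_exact`.
  let n₀ : ℤ × ℤ → ℕ := fun x => max (S x) (x.2 - q₀ (x.1 + x.2)).toNat
  have hn₀ : ∀ x, C.IsStable x (n₀ x) := fun x => (hS x).mono (le_max_left _ _)
  have hn₀2 : ∀ x, (2 + (n₀ x : ℤ) - 2).toNat = n₀ x := fun x => by omega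
  have hn₀' : ∀ x, C.IsStable x (2 + (n₀ x : ℤ) - 2).toNat := fun x => (hn₀2 x).symm ▸ hn₀ x
  have hline : ∀ (n : ℤ) (l : ℤ), (n - (q₀ n + l), q₀ n + l) = (n - q₀ n, q₀ n) + l • C.i.deg := by
    intro n l
    rw [hi]
    ext <;> simp
    ring
  refine ⟨fun p q => ⟨Iso.refl _⟩, fun x => 2 + n₀ x, fun x => by simp, ?_, fun n => ?_⟩
  · intro x r hr y
    have hr : 2 + (n₀ x : ℤ) ≤ r := hr
    have hm : n₀ x ≤ (r - 2).toNat := by omega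
    have hr' : (C.iterDerive (r - 2).toNat).d.deg = (r, 1 - r) := by
      rw [iterDerive_d_deg, hi, hd]
      ext <;> simp <;> omega
    exact ⟨(hn₀ x).complex_d_from hm _ hr' y, (hn₀ x).complex_d_to hm _ hr' y⟩
  · obtain ⟨m, hm⟩ := hC (n - q₀ n, q₀ n)
    -- `F_t` is the image of the `t`-fold iterate of `i` from the index `q₀`, and `m` is the bound
    -- beyond which `D` vanishes on this line.
    refine ⟨q₀ n, m, ⟨fun t => AddCommGrpCat.of ((C.iterDerive t).D (n - (q₀ n + t), q₀ n + t)),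
      ?_, ?_, fun t ht => ?_⟩, fun q hq' => ?_⟩
    · refine ⟨eqToIso (congrArg (fun q => AddCommGrpCat.of (C.D (n - q, q))) ?_)⟩
      exact add_zero (q₀ n)
    · refine C.subsingleton_iterDerive_D ?_ m
      rw [hline, natCast_zsmul]
      exact (hm m le_rfl).2
    · let w : ℤ × ℤ := (n - (q₀ n + t), q₀ n + t)
      refine (hn₀' w).exists_exact ?_ (by rw [hk, add_zero]) ?_ fun m htm v h =>
        C.surjective_iterDerive_i (n - q₀ n, q₀ n) ?_ m t htm v w ?_ h
      · rw [hn₀2]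
        refine le_trans ?_ (le_max_right _ _)
        simp [w]
      · rw [hi]
        ext <;> simp <;> ring
      · intro l v h
        obtain rfl : v = (n - (q₀ n - l - 1), q₀ n - l - 1) := by
          rw [eq_sub_of_add_eq h, hi]
          ext <;> simp
          ring
        exact (hq n _ (by omega) _ h).2
      · rw [← natCast_zsmul]
        exact hline n t
    · change Subsingleton ((C.iterDerive (2 + (n₀ (n - q, q) : ℤ) - 2).toNat).E (n - q, q))
      refine (hn₀' _).subsingleton (by rw [hk, add_zero]) rfl ?_
      -- Outside the range `i` is injective, before it by hypothesis and after it because its source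
      -- is zero; this kills the limit term.
      rcases hq' with hq' | hq'
      · exact (hq n q hq' _ _).1
      · obtain ⟨l, rfl⟩ : ∃ l : ℕ, q = q₀ n + l := ⟨(q - q₀ n).toNat, by omega⟩
        have : Subsingleton (C.D (n - (q₀ n + l), q₀ n + l)) := by
          rw [hline, natCast_zsmul]
          exact (hm l (by omega)).2
        exact Function.injective_of_subsingleton _

/-! ### The exact couple of a tower of spectra -/

lemma Spectrum.bijective_structTo (X : Spectrum.{u}) (m m' : ℤ) (h : m + 1 = m') :
    Function.Bijective (X.toPrespectrum.structTo m m' h).pi2 := by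
  subst h
  exact (X.isWeakEquiv m).bijective 2 (X.struct m).map_pt

lemma SpectrumMap.structTo_comm {X Y : Prespectrum.{u}} (f : SpectrumMap X Y) (m m' : ℤ)
    (h : m + 1 = m') (a : (X.space m).pi2) :
    (Y.structTo m m' h).pi2 ((f.map m).pi2 a) =
      (f.map m').loop.pi2 ((X.structTo m m' h).pi2 a) := by
  subst h
  have := DFunLike.congr_fun (PtdMap.pi2_congr (f.comm m)) a
  rwa [PtdMap.pi2_comp, PtdMap.pi2_comp] at this

namespace SpectrumMap

variable {X Y : Spectrum.{u}} (f : SpectrumMap X.toPrespectrum Y.toPrespectrum)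

/-- Exactness at `π_2(ΩY_m)`, transported along the structure maps: surjectivity for `X` and
injectivity for `Y` pull the preimage back. -/
lemma exact_homotopyMap_connecting (n : ℤ) :
    Function.Exact (f.homotopyMap (n + 1)) (f.connecting n) := by
  intro b
  have h : (2 - (n + 1)) + 1 = 2 - n := by ring
  refine ((f.map (2 - n)).exact_loop_fiberIncl _).trans ⟨?_, ?_⟩
  · rintro ⟨a, ha⟩
    obtain ⟨a, rfl⟩ := (X.bijective_structTo _ _ h).2 a
    exact ⟨a, (Y.bijective_structTo _ _ h).1 ((f.structTo_comm _ _ h a).trans ha)⟩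
  · rintro ⟨a, rfl⟩
    exact ⟨_, (f.structTo_comm _ _ h a).symm⟩

lemma exact_connecting_fiberProj (n : ℤ) :
    Function.Exact (f.connecting n) (f.fiberProj.homotopyMap n) := by
  intro b
  refine ((f.map (2 - n)).exact_fiberIncl_fiberProj b).trans ⟨?_, ?_⟩
  · rintro ⟨a, rfl⟩
    obtain ⟨a, rfl⟩ := (Y.bijective_structTo (2 - (n + 1)) (2 - n) (by ring)).2 a
    exact ⟨a, rfl⟩
  · rintro ⟨a, rfl⟩
    exact ⟨_, rfl⟩

lemma exact_fiberProj_homotopyMap (n : ℤ) :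
    Function.Exact (f.fiberProj.homotopyMap n) (f.homotopyMap n) :=
  (f.map (2 - n)).exact_fiberProj

end SpectrumMap

lemma gradedCast_bijective {G : Type v} (M : G → Type u) [∀ x, AddCommGroup (M x)] {x y : G}
    (h : x = y) : Function.Bijective (gradedCast M h) := by
  subst h
  exact Function.bijective_id

section Tower

variable (A : ℤ → Spectrum.{u})
  (f : ∀ s : ℤ, SpectrumMap (A s).toPrespectrum (A (s - 1)).toPrespectrum)

/-- Once the indices are solved for and substituted, every `gradedCast` is an identity by
definition, and the claims are those for a single `f s`. -/
lemma isExact_towerCouple : (towerCouple A f).IsExact where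
  exact_ij := by
    rintro ⟨n, s⟩ y ⟨n', s'⟩ h h'
    obtain rfl : y = (n, s - 1) := by
      rw [← h]; exact Prod.ext (add_zero n) rfl
    obtain ⟨h1, h2⟩ := Prod.ext_iff.1 h'
    obtain rfl : n = n' + 1 := by
      have : n + (-1) = n' := h1
      omega
    obtain rfl : s = s' := by
      have : s - 1 + 1 = s' := h2
      omega
    exact (f s).exact_homotopyMap_connecting n'
  exact_jk := by
    rintro x ⟨n, s⟩ z h h'
    obtain rfl : z = (n, s) := by rw [← h']; exact add_zero _
    obtain rfl : x = (n + 1, s - 1) := by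
      rw [eq_sub_of_add_eq h]; exact Prod.ext (sub_neg_eq_add n 1) rfl
    exact (f s).exact_connecting_fiberProj n
  exact_ki := by
    rintro ⟨n, s⟩ y z h h'
    obtain rfl : y = (n, s) := by rw [← h]; exact add_zero _
    obtain rfl : z = (n, s - 1) := by
      rw [← h']; exact Prod.ext (add_zero n) rfl
    exact (f s).exact_fiberProj_homotopyMap n

/-- The homotopy groups of the fiber vanish where two adjacent maps are bijective. -/
lemma subsingleton_towerE {n s : ℤ} (h₁ : Function.Bijective ((f s).homotopyMap n))
    (h₂ : Function.Bijective ((f s).homotopyMap (n + 1))) :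
    Subsingleton ((f s).fiber.homotopyGroup n) := by
  refine subsingleton_of_forall_eq 0 fun a => ?_
  have h0 : (f s).fiberProj.homotopyMap n a = 0 := h₁.1 <| by
    rw [((f s).exact_fiberProj_homotopyMap n).apply_apply_eq_zero, map_zero]
  obtain ⟨b, rfl⟩ := ((f s).exact_connecting_fiberProj n a).1 h0
  obtain ⟨c, rfl⟩ := h₂.2 b
  exact ((f s).exact_homotopyMap_connecting n).apply_apply_eq_zero c

lemma isBounded_towerExactCouple (β γ : ℤ → ℤ)
    (hβ : ∀ n s : ℤ, s ≤ β n → Subsingleton ((A s).homotopyGroup n))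
    (hγ : ∀ n s : ℤ, γ n < s → Function.Bijective ((f s).homotopyMap n)) :
    (towerExactCouple A f (isExact_towerCouple A f)).IsBounded := by
  rintro ⟨n, s⟩
  have hdeg : (towerExactCouple A f (isExact_towerCouple A f)).i.deg = (0, -1) := rfl
  -- The first bound puts `s - t` at or below `β n`. The second puts `s + t` above both `γ n` and `γ
  -- (n + 1)`, since `E` in degree `n` also sees `π_{n+1}`.
  refine ⟨(max (s - β n) (max (γ n) (γ (n + 1)) + 1 - s)).toNat, fun t ht => ?_⟩
  have h1 : (n, s) - t • (0, -1) = ((n, s + t) : ℤ × ℤ) := by ext <;> simp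
  have h2 : (n, s) + t • (0, -1) = ((n, s - t) : ℤ × ℤ) := by ext <;> simp [sub_eq_add_neg]
  rw [hdeg, h1, h2]
  exact ⟨subsingleton_towerE A f (hγ n _ (by omega)) (hγ (n + 1) _ (by omega)),
    hβ n _ (by omega)⟩

end Tower

lemma ExactCouple.IsBounded.reindex {G H : Type v} [AddCommGroup G] [AddCommGroup H]
    {C : ExactCouple.{u} G} (hC : C.IsBounded) (e : H ≃+ G) : (C.reindex e).IsBounded := by
  intro x
  obtain ⟨B, hB⟩ := hC (e x)
  refine ⟨B, fun s hs => ?_⟩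
  change Subsingleton (C.E (e (x - s • e.symm C.i.deg))) ∧
    Subsingleton (C.D (e (x + s • e.symm C.i.deg)))
  rw [map_sub, map_add, map_nsmul, e.apply_symm_apply]
  exact hB s hs

end SpectralTower

theorem mainTheorem3 (A : ℤ → SpectralTower.Spectrum.{u})
    (f : ∀ s : ℤ, SpectralTower.SpectrumMap (A s).toPrespectrum (A (s - 1)).toPrespectrum)
    (β γ : ℤ → ℤ)
    (hβ : ∀ n s : ℤ, s ≤ β n → Subsingleton ((A s).homotopyGroup n))
    (hγ : ∀ n s : ℤ, γ n < s → Function.Bijective ((f s).homotopyMap n)) :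
    ∃ h : (SpectralTower.towerCouple A f).IsExact,
      (SpectralTower.towerExactCouple A f h).IsBounded ∧
      SpectralTower.ConvergesTo (SpectralTower.towerSpectralSequence A f h)
        (fun p q => AddCommGrpCat.of ((f (-q)).fiber.homotopyGroup (-(p + q))))
        (fun n => AddCommGrpCat.of ((A (γ (-n))).homotopyGroup (-n))) := by
  open SpectralTower in
  have hb := isBounded_towerExactCouple A f β γ hβ hγ
  refine ⟨isExact_towerCouple A f, hb, ?_⟩
  have h := ((towerExactCouple A f (isExact_towerCouple A f)).reindex
    baseChange).convergesTo_spectralSequence rfl rfl rfl (hb.reindex baseChange)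
    -- Total degree `n` corresponds to `π_{-n}`, and `q = -s`; thus `q < -γ (-n)` says `s > γ (-n)`.
    (fun n => -γ (-n)) ?_
  -- The abutment indices agree only after cancellation in `ℤ`, hence the rewriting; the second
  -- pages agree by definition.
  · have hD : (fun n : ℤ => AddCommGrpCat.of (towerD A (baseChange (n - -γ (-n), -γ (-n))))) =
        fun n => AddCommGrpCat.of ((A (γ (-n))).homotopyGroup (-n)) := by
      funext n
      have : baseChange (n - -γ (-n), -γ (-n)) = (-n, γ (-n)) := by simp [baseChange]
      rw [this]
    rw [← hD]
    exact h
  · intro n q hq y hy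
    refine (gradedCast_bijective (towerD A) _).comp (hγ _ _ ?_)
    change γ (-(n - q + q)) < -q
    rw [sub_add_cancel]
    omega
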